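/- Let $G$ be a locally compact second countable (Hausdorff) Abelian group, $H\subset G$ a closed co-compact subgroup, $Y=G/H$, and $\lambda$ the Haar probability measure on $Y$. Fix a Borel cross-section $s:Y\to G$ of the projection $G\to Y$ with $s(H)=0$, and put $h(g,y):=-s(gy)+g+s(y)\in H$ for $g\in G$, $y\in Y$, where $gy$ denotes the translate of $y$ by $g$. For a measure preserving (Borel) action $S=(S_h)_{h\in H}$ on a standard probability space $(X,\mu)$, the induced $G$-action is the action $T_g(y,x)=(gy,S_{h(g,y)}x)$ on $(Y\times X,\lambda\times\mu)$. An ergodic self-joining of an action on $(Z,\nu)$ is a measure on $Z\times Z$ with both marginals equal to $\nu$ that is invariant and ergodic under the diagonal action. An isomorphism of actions is a measure preserving map, invertible modulo null sets, that commutes almost everywhere with each element of the acting group. A self-joining of an action on $(Z,\nu)$ is a graph of an isomorphism if it is the image of $\nu$ under $z\mapsto(z,Rz)$ for some isomorphism $R$ of the action with itself. **Proposition 1.3.** (a) Let $S$ be an ergodic action of $H$ on $(X,\mu)$, let $T$ be the induced $G$-action, and let $\rho$ be an ergodic self-joining of $T$. Then there are an ergodic self-joining $\kappa$ of $S$ and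 an element $g\in G$ such that $$\rho=\int_{G/H}\kappa_y\times\delta_y\times\delta_{gy}\,d\lambda(y),\qquad \kappa_y:=(S_{h(s(y),H)}\times S_{h(s(y),gH)})_*\,\kappa ,$$ where $X\times X\times Y\times Y$ is identified with $(Y\times X)\times(Y\times X)$ by $(x_1,x_2,y_1,y_2)\mapsto((y_1,x_1),(y_2,x_2))$; moreover $(Y\times X\times Y\times X,\rho,(T_g\times T_g)_{g\in G})$ is an induced action: it is isomorphic to the $G$-action induced by the $H$-action $(S_h\times S_h)_{h\in H}$ on $(X\times X,\kappa)$. Whenever $\kappa$ is an ergodic self-joining of $S$ and $g\in G$ is such that this formula holds, $\rho$ is a graph of an isomorphism if and only if $\kappa$ is. (b) If $S$ and $S'$ are measure preserving actions of $H$ on standard probability spaces, then the $G$-actions induced by $S$ and $S'$ are isomorphic if and only if $S$ and $S'$ are isomorphic. -/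

import Mathlib

open MeasureTheory

/-- A Borel cross-section `s : G/H → G` of the projection `G → G/H`, normalised by `s(H) = 0`. -/
structure BorelSection {G : Type*} [AddCommGroup G] [MeasurableSpace G] (H : AddSubgroup G) where
  toFun : G ⧸ H → G
  measurable_toFun : Measurable toFun
  mk_toFun : ∀ y : G ⧸ H, (QuotientAddGroup.mk (toFun y) : G ⧸ H) = y
  map_zero : toFun 0 = 0

namespace BorelSection

variable {G : Type*} [AddCommGroup G] [MeasurableSpace G] {H : AddSubgroup G}

instance : CoeFun (BorelSection H) (fun _ => G ⧸ H → G) := ⟨BorelSection.toFun⟩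

/-- The cocycle `h(g, y) = -s(gy) + g + s(y)`, an element of `H`. -/
def cocycle (s : BorelSection H) (g : G) (y : G ⧸ H) : H :=
  ⟨-s ((g : G ⧸ H) + y) + g + s y, by
    rw [← QuotientAddGroup.eq_zero_iff]
    simp [QuotientAddGroup.mk_add, QuotientAddGroup.mk_neg, s.mk_toFun]⟩

theorem cocycle_zero (s : BorelSection H) (y : G ⧸ H) : s.cocycle 0 y = 0 := by
  apply Subtype.ext
  simp [cocycle]

theorem cocycle_add (s : BorelSection H) (g₁ g₂ : G) (y : G ⧸ H) :
    s.cocycle (g₁ + g₂) y = s.cocycle g₁ ((g₂ : G ⧸ H) + y) + s.cocycle g₂ y := by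
  apply Subtype.ext
  simp only [cocycle, QuotientAddGroup.mk_add, AddSubgroup.coe_add, add_assoc]
  abel

end BorelSection

/-- The space `G/H × X` of the induced action (the section is a parameter because the formula
for the action depends on it). -/
def Induced {G : Type*} [AddCommGroup G] [MeasurableSpace G] {H : AddSubgroup G}
    (_s : BorelSection H) (X : Type*) : Type _ :=
  (G ⧸ H) × X

namespace Induced

variable {G : Type*} [AddCommGroup G] [MeasurableSpace G] {H : AddSubgroup G}
  {s : BorelSection H} {X : Type*}

instance [MeasurableSpace X] : MeasurableSpace (Induced s X) :=
  inferInstanceAs (MeasurableSpace ((G ⧸ H) × X))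

/-- The point `(y, x)` of `G/H × X`. -/
def mk (s : BorelSection H) (y : G ⧸ H) (x : X) : Induced s X := (y, x)

/-- The induced action `T_g (y, x) = (gy, S_{h(g, y)} x)`. -/
instance [AddAction H X] : AddAction G (Induced s X) where
  vadd g z := mk s ((g : G ⧸ H) + z.1) (s.cocycle g z.1 +ᵥ z.2)
  zero_vadd z := by
    change mk s (((0 : G) : G ⧸ H) + z.1) (s.cocycle 0 z.1 +ᵥ z.2) = z
    rw [s.cocycle_zero, zero_vadd, QuotientAddGroup.mk_zero, zero_add]
    rfl
  add_vadd g₁ g₂ z := by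
    change mk s (((g₁ + g₂ : G) : G ⧸ H) + z.1) (s.cocycle (g₁ + g₂) z.1 +ᵥ z.2) =
      mk s ((g₁ : G ⧸ H) + ((g₂ : G ⧸ H) + z.1))
        (s.cocycle g₁ ((g₂ : G ⧸ H) + z.1) +ᵥ (s.cocycle g₂ z.1 +ᵥ z.2))
    rw [s.cocycle_add, add_vadd, QuotientAddGroup.mk_add, add_assoc]

theorem vadd_mk [AddAction H X] (g : G) (y : G ⧸ H) (x : X) :
    g +ᵥ mk s y x = mk s ((g : G ⧸ H) + y) (s.cocycle g y +ᵥ x) := rfl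

/-- The product measure `λ × μ` on `G/H × X`. -/
noncomputable def measure [MeasurableSpace X] (s : BorelSection H) (lam : Measure (G ⧸ H))
    (μ : Measure X) : Measure (Induced s X) :=
  (lam.prod μ : Measure ((G ⧸ H) × X))

end Induced

section Actions

variable (Γ : Type*) {α β : Type*} [MeasurableSpace α] [MeasurableSpace β] [VAdd Γ α] [VAdd Γ β]

/-- `φ` is an isomorphism of the `Γ`-actions on `(α, μ)` and `(β, ν)`: it preserves the measure,
is invertible modulo null sets, and intertwines the actions almost everywhere. -/
def IsActionIso (μ : Measure α) (ν : Measure β) (φ : α → β) : Prop :=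
  MeasurePreserving φ μ ν ∧
  (∃ ψ : β → α, MeasurePreserving ψ ν μ ∧ (∀ᵐ x ∂μ, ψ (φ x) = x) ∧ (∀ᵐ y ∂ν, φ (ψ y) = y)) ∧
  ∀ γ : Γ, ∀ᵐ x ∂μ, φ (γ +ᵥ x) = γ +ᵥ φ x

/-- The `Γ`-actions on `(α, μ)` and `(β, ν)` are isomorphic. -/
def ActionIsomorphic (μ : Measure α) (ν : Measure β) : Prop :=
  ∃ φ : α → β, IsActionIso Γ μ ν φ

/-- `ρ` is an ergodic self-joining of the `Γ`-action on `(α, μ)`: both coordinate marginals of `ρ`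
are `μ`, and `ρ` is invariant and ergodic for the diagonal action on `α × α`
(`ErgodicVAdd` contains the invariance). -/
structure IsErgodicSelfJoining (μ : Measure α) (ρ : Measure (α × α)) : Prop where
  map_fst : ρ.map Prod.fst = μ
  map_snd : ρ.map Prod.snd = μ
  ergodic : ErgodicVAdd Γ (α × α) ρ

/-- `ρ` is the graph of an isomorphism of the `Γ`-action on `(α, μ)` with itself. -/
def IsGraphOfIso (μ : Measure α) (ρ : Measure (α × α)) : Prop :=
  ∃ R : α → α, IsActionIso Γ μ μ R ∧ ρ = μ.map (fun x => (x, R x))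

end Actions

section Formula

variable {G : Type*} [AddCommGroup G] [MeasurableSpace G] {H : AddSubgroup G}
  {X : Type*} [MeasurableSpace X] [AddAction H X]

/-- The image `κ_y` of `κ` under `S_{h(s(y), H)} × S_{h(s(y), gH)}`. -/
noncomputable def fibreMeasure (s : BorelSection H) (κ : Measure (X × X)) (g : G) (y : G ⧸ H) :
    Measure (X × X) :=
  κ.map (fun p => (s.cocycle (s y) 0 +ᵥ p.1, s.cocycle (s y) (g : G ⧸ H) +ᵥ p.2))

/-- `ρ = ∫ κ_y × δ_y × δ_{gy} dλ(y)`, where `X × X × G/H × G/H` is identified with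
`(G/H × X) × (G/H × X)` by `(x₁, x₂, y₁, y₂) ↦ ((y₁, x₁), (y₂, x₂))`. -/
def IsIntegralOfFibres (s : BorelSection H) (lam : Measure (G ⧸ H)) (κ : Measure (X × X)) (g : G)
    (ρ : Measure (Induced s X × Induced s X)) : Prop :=
  ∀ A : Set (Induced s X × Induced s X), MeasurableSet A →
    ρ A = ∫⁻ y, ((fibreMeasure s κ g y).prod
        ((Measure.dirac y).prod (Measure.dirac ((g : G ⧸ H) + y)))).map
      (fun q => (Induced.mk s q.2.1 q.1.1, Induced.mk s q.2.2 q.1.2)) A ∂lam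

end Formula

/-! Write `Y = G/H`. A pair `((y₁, x₁), (y₂, x₂))` is described by `y₁`, the difference `c = y₂ -
y₁`, the point `x₁`, and `x₂` carried back by the cocycle value `h(s(y₁), c)`. In these coordinates
(`untwist`) the diagonal `G`-action is again of induced form over `y₁`: `H` acts diagonally on the
two fibre points and fixes `c` (`twist_skewMap`).

The engine is `eq_prod_of_map_skewMap`: an invariant measure `σ` of an induced action that projects
to `λ` is `λ × κ'` with `κ'` invariant under `H`. Averaging over `G` with a positive integrable
weight gives a function `W` on `Y` such that `∫ W φ dσ` depends only on the fibre marginal of `σ`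
(`lintegral_weight_mul`). The product of `λ` with that marginal is invariant too, and `W` is
positive and a.e. finite, so the two measures agree. Hence every invariant joining is the `twist`
image of some `λ × κ'`. That the second marginal of `κ'` is right needs a second use of the engine,
based at `y₂` (`map_untwist_snd`).

If the joining is ergodic, the invariant function `c` is constant, so `κ' = κ × δ_c`, which is the
integral formula. Ergodicity descends to `κ` because an `H`-invariant set `A` gives the
`G`-invariant set `Y × A`. Being carried by a graph can be tested on a single fibre, since the
measure is a product.

For (b), an isomorphism of induced actions is treated through its graph joining. There `c` may vary,
but almost surely it is a function of either fibre coordinate, so one fibre again yields an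
isomorphism of the `H`-actions. -/

open scoped ENNReal

/-! ### Measurability on the quotient and cocycle identities -/

namespace BorelSection

variable {G : Type*} [AddCommGroup G] [MeasurableSpace G] {H : AddSubgroup G}

theorem injective (s : BorelSection H) : Function.Injective s := fun a b h => by
  rw [← s.mk_toFun a, ← s.mk_toFun b, h]

theorem measurable_mk : Measurable (QuotientAddGroup.mk : G → G ⧸ H) :=
  fun _ h => h

theorem measurableAdd₂ [MeasurableAdd₂ G] (s : BorelSection H) : MeasurableAdd₂ (G ⧸ H) where
  measurable_add := by
    have h : (fun p : (G ⧸ H) × (G ⧸ H) => p.1 + p.2) =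
        fun p => (QuotientAddGroup.mk (s p.1 + s p.2) : G ⧸ H) := by
      ext p
      simp [QuotientAddGroup.mk_add, s.mk_toFun]
    rw [h]
    exact measurable_mk.comp ((s.measurable_toFun.comp measurable_fst).add
      (s.measurable_toFun.comp measurable_snd))

theorem measurableNeg [MeasurableNeg G] (s : BorelSection H) : MeasurableNeg (G ⧸ H) where
  measurable_neg := by
    have h : (fun y : G ⧸ H => -y) = fun y => (QuotientAddGroup.mk (-s y) : G ⧸ H) := by
      ext y
      simp [QuotientAddGroup.mk_neg, s.mk_toFun]
    change Measurable fun y : G ⧸ H => -y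
    rw [h]
    exact measurable_mk.comp s.measurable_toFun.neg

theorem measurableEq [MeasurableEq G] (s : BorelSection H) : MeasurableEq (G ⧸ H) where
  measurableSet_diagonal := by
    have h : Set.diagonal (G ⧸ H) = {p | s p.1 = s p.2} := by
      ext p
      exact s.injective.eq_iff.symm
    rw [h]
    exact measurableSet_eq_fun (s.measurable_toFun.comp measurable_fst)
      (s.measurable_toFun.comp measurable_snd)

theorem measurable_cocycle [MeasurableAdd₂ G] [MeasurableNeg G] (s : BorelSection H) :
    Measurable fun p : G × (G ⧸ H) => s.cocycle p.1 p.2 := by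
  have := s.measurableAdd₂
  have hs := s.measurable_toFun
  have hm : Measurable (QuotientAddGroup.mk : G → G ⧸ H) := measurable_mk
  refine Measurable.subtype_mk ?_
  fun_prop

theorem cocycle_of_mem (s : BorelSection H) (h : H) (y : G ⧸ H) : s.cocycle (h : G) y = h := by
  apply Subtype.ext
  have : ((h : G) : G ⧸ H) = 0 := (QuotientAddGroup.eq_zero_iff _).2 h.2
  simp only [cocycle, this, zero_add]
  abel

theorem cocycle_section_zero (s : BorelSection H) (y : G ⧸ H) : s.cocycle (s y) 0 = 0 := by
  apply Subtype.ext
  simp [cocycle, s.mk_toFun, s.map_zero]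

/-- Both sides reduce to `-s(g + y + c) + g + s(y) + s(c)`. This makes the transport by `h(s(y), c)`
from the fibre over `y` to the fibre over `y + c` commute with the induced action. -/
theorem cocycle_add_cocycle_section (s : BorelSection H) (g : G) (y c : G ⧸ H) :
    s.cocycle g (y + c) + s.cocycle (s y) c =
      s.cocycle (s ((g : G ⧸ H) + y)) c + s.cocycle g y := by
  apply Subtype.ext
  simp only [cocycle, AddSubgroup.coe_add, s.mk_toFun, add_assoc]
  abel

end BorelSection

/-! ### Invariant measures of induced transformations are products -/

section Uniqueness

variable {G : Type*} [AddCommGroup G] [TopologicalSpace G] [IsTopologicalAddGroup G]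
  [SecondCountableTopology G] [MeasurableSpace G] [BorelSpace G] {H : AddSubgroup G}
  {Z : Type*} [MeasurableSpace Z] {act : H → Z → Z}

/-- The induced transformation of `G/H × Z` defined by a family `act` of maps of `Z`. -/
def skewMap (s : BorelSection H) (act : H → Z → Z) (g : G) (p : (G ⧸ H) × Z) : (G ⧸ H) × Z :=
  ((g : G ⧸ H) + p.1, act (s.cocycle g p.1) p.2)

theorem measurable_skewMap (s : BorelSection H) (hact : Measurable (Function.uncurry act)) :
    Measurable fun q : G × ((G ⧸ H) × Z) => skewMap s act q.1 q.2 := by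
  have := s.measurableAdd₂
  have hm : Measurable (QuotientAddGroup.mk : G → G ⧸ H) := BorelSection.measurable_mk
  have hc := s.measurable_cocycle
  refine Measurable.prodMk (by fun_prop) (hact.comp (Measurable.prodMk
    (hc.comp (Measurable.prodMk measurable_fst measurable_snd.fst)) measurable_snd.snd))

theorem measurable_skewMap_apply (s : BorelSection H) (hact : Measurable (Function.uncurry act))
    (g : G) : Measurable (skewMap s act g) :=
  (measurable_skewMap s hact).comp measurable_prodMk_left

/-- An element `h` of `H` fixes every point of the quotient and has cocycle value `h` there, so the
induced transformation is `act h` on every fibre. -/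
theorem map_act_snd (s : BorelSection H) (hact : Measurable (Function.uncurry act))
    {σ : Measure ((G ⧸ H) × Z)} (hσ : ∀ g, σ.map (skewMap s act g) = σ) (h : H) :
    (σ.map Prod.snd).map (act h) = σ.map Prod.snd := by
  have ha : Measurable (act h) := hact.comp measurable_prodMk_left
  conv_rhs => rw [← hσ h]
  rw [Measure.map_map ha measurable_snd, Measure.map_map measurable_snd
    (measurable_skewMap_apply s hact h)]
  congr 1
  ext p
  simp [skewMap, s.cocycle_of_mem]

/-- The right side sees `σ` only through its fibre marginal. This is what forces two invariant
measures with the same fibre marginal to coincide. -/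
theorem lintegral_weight_mul (s : BorelSection H) (hact : Measurable (Function.uncurry act))
    (m : Measure G) [m.IsAddLeftInvariant] [SFinite m] {w : G → ℝ≥0∞} (hw : Measurable w)
    {σ : Measure ((G ⧸ H) × Z)} [SFinite σ] (hσ : ∀ g, σ.map (skewMap s act g) = σ)
    {φ : (G ⧸ H) × Z → ℝ≥0∞} (hφ : Measurable φ) :
    ∫⁻ p, (∫⁻ g, w (g + s (-(g : G ⧸ H) + p.1)) ∂m) * φ p ∂σ =
      ∫⁻ a, w a * ∫⁻ z, φ ((a : G ⧸ H), z) ∂(σ.map Prod.snd) ∂m := by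
  have := s.measurableAdd₂
  have := s.measurableNeg
  have hs := s.measurable_toFun
  have hm : Measurable (QuotientAddGroup.mk : G → G ⧸ H) := BorelSection.measurable_mk
  have hT := measurable_skewMap s hact
  have hW : Measurable fun q : ((G ⧸ H) × Z) × G => w (q.2 + s (-(q.2 : G ⧸ H) + q.1.1)) := by
    fun_prop
  -- With `a = g + s y`, the cocycle value `h(g, y)` is `-s(a + H) + a`, which no longer involves
  -- `y` separately.
  let τ : G → H := fun a => ⟨-s a + a, by
    rw [← QuotientAddGroup.eq_zero_iff]
    simp [QuotientAddGroup.mk_add, QuotientAddGroup.mk_neg, s.mk_toFun]⟩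
  have hτ : Measurable τ := Measurable.subtype_mk (by fun_prop)
  calc _ = ∫⁻ p, ∫⁻ g, w (g + s (-(g : G ⧸ H) + p.1)) * φ p ∂m ∂σ := by
        refine lintegral_congr fun p => (lintegral_mul_const _ ?_).symm
        exact hW.comp measurable_prodMk_left
    _ = ∫⁻ g, ∫⁻ p, w (g + s (-(g : G ⧸ H) + p.1)) * φ p ∂σ ∂m :=
        lintegral_lintegral_swap (hW.mul (hφ.comp measurable_fst)).aemeasurable
    -- Invariance of `σ` under `g`; the shift `-g` inside the weight cancels the translation of the
    -- base.
    _ = ∫⁻ g, ∫⁻ p, w (g + s p.1) * φ (skewMap s act g p) ∂σ ∂m := by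
        refine lintegral_congr fun g => ?_
        conv_lhs => rw [← hσ g]
        rw [lintegral_map (by fun_prop) (measurable_skewMap_apply s hact g)]
        simp [skewMap]
    _ = ∫⁻ p, ∫⁻ g, w (g + s p.1) * φ (skewMap s act g p) ∂m ∂σ := by
        refine lintegral_lintegral_swap (Measurable.aemeasurable ?_)
        have := hφ.comp hT
        exact Measurable.mul (by fun_prop) this
    _ = ∫⁻ p, ∫⁻ a, w a * φ ((a : G ⧸ H), act (τ a) p.2) ∂m ∂σ := by
        refine lintegral_congr fun p => ?_
        rw [← lintegral_add_right_eq_self (fun a => w a * φ ((a : G ⧸ H), act (τ a) p.2)) (s p.1)]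
        refine lintegral_congr fun g => ?_
        simp only [skewMap, BorelSection.cocycle, τ, QuotientAddGroup.mk_add, s.mk_toFun,
          add_assoc]
    _ = ∫⁻ a, ∫⁻ p, w a * φ ((a : G ⧸ H), act (τ a) p.2) ∂σ ∂m := by
        refine lintegral_lintegral_swap (Measurable.aemeasurable ?_)
        have h1 : Measurable fun q : ((G ⧸ H) × Z) × G => act (τ q.2) q.1.2 :=
          hact.comp (Measurable.prodMk (by fun_prop) (by fun_prop))
        exact Measurable.mul (by fun_prop) (hφ.comp (Measurable.prodMk (by fun_prop) h1))
    _ = _ := by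
        refine lintegral_congr fun a => ?_
        have h1 : Measurable (act (τ a)) := hact.comp measurable_prodMk_left
        have h2 : Measurable fun z => φ ((a : G ⧸ H), z) := hφ.comp measurable_prodMk_left
        -- The remaining `act (τ a)` is absorbed because the fibre marginal is invariant under `H`.
        rw [← map_act_snd s hact hσ (τ a), lintegral_map h2 h1]
        have h3 : Measurable fun z => φ ((a : G ⧸ H), act (τ a) z) := h2.comp h1
        rw [← lintegral_const_mul _ h3, lintegral_map (h3.const_mul _) measurable_snd]

theorem map_skewMap_prod (s : BorelSection H) (hact : Measurable (Function.uncurry act))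
    (lam : Measure (G ⧸ H)) [lam.IsAddLeftInvariant] [SFinite lam] {κ : Measure Z} [SFinite κ]
    (hκ : ∀ h, κ.map (act h) = κ) (g : G) :
    (lam.prod κ).map (skewMap s act g) = lam.prod κ := by
  have := s.measurableAdd₂
  refine (MeasurePreserving.skew_product (f := fun y : G ⧸ H => (g : G ⧸ H) + y)
    (g := fun y => act (s.cocycle g y)) (measurePreserving_add_left lam _) ?_ ?_).map_eq
  · exact hact.comp (Measurable.prodMk ((s.measurable_cocycle.comp measurable_prodMk_left).comp
      measurable_fst) measurable_snd)
  · exact Filter.Eventually.of_forall fun y => hκ _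

/-- An invariant measure of the induced transformations whose projection to `G/H` is `lam`
is the product of `lam` with a measure invariant under `act`. -/
theorem eq_prod_of_map_skewMap [LocallyCompactSpace G] [T2Space G] (s : BorelSection H)
    (hact : Measurable (Function.uncurry act))
    (lam : Measure (G ⧸ H)) [lam.IsAddLeftInvariant] [IsProbabilityMeasure lam]
    {σ : Measure ((G ⧸ H) × Z)} (hσ : ∀ g, σ.map (skewMap s act g) = σ)
    (hfst : σ.map Prod.fst = lam) : σ = lam.prod (σ.map Prod.snd) := by
  have := s.measurableAdd₂
  have := s.measurableNeg
  have hs := s.measurable_toFun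
  have hm : Measurable (QuotientAddGroup.mk : G → G ⧸ H) := BorelSection.measurable_mk
  have hp : IsProbabilityMeasure σ := by
    have : IsProbabilityMeasure (σ.map Prod.fst) := by rw [hfst]; infer_instance
    exact Measure.isProbabilityMeasure_of_map Prod.fst
  have : IsProbabilityMeasure (σ.map Prod.snd) :=
    Measure.isProbabilityMeasure_map measurable_snd.aemeasurable
  let m : Measure G := Measure.addHaar
  -- Haar measure on `G` may be infinite, so the average uses a strictly positive weight of finite
  -- integral.
  obtain ⟨w, wpos, wmeas, wint⟩ := exists_pos_lintegral_lt_of_sigmaFinite m one_ne_zero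
  have hw : Measurable fun a => (w a : ℝ≥0∞) := wmeas.coe_nnreal_ennreal
  let W : G ⧸ H → ℝ≥0∞ := fun y => ∫⁻ g, w (g + s (-(g : G ⧸ H) + y)) ∂m
  have hW : Measurable W := by
    refine Measurable.lintegral_prod_right' (f := fun q : (G ⧸ H) × G =>
      (w (q.2 + s (-(q.2 : G ⧸ H) + q.1)) : ℝ≥0∞)) ?_
    fun_prop
  have hσ' : ∀ g, (lam.prod (σ.map Prod.snd)).map (skewMap s act g) =
      lam.prod (σ.map Prod.snd) :=
    map_skewMap_prod s hact lam (map_act_snd s hact hσ)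
  have key {φ : (G ⧸ H) × Z → ℝ≥0∞} (hφ : Measurable φ) :
      ∫⁻ p, W p.1 * φ p ∂σ = ∫⁻ p, W p.1 * φ p ∂(lam.prod (σ.map Prod.snd)) := by
    rw [lintegral_weight_mul s hact m hw hσ hφ, lintegral_weight_mul s hact m hw hσ' hφ,
      Measure.map_snd_prod]
    simp
  have hW0 (y : G ⧸ H) : W y ≠ 0 := by
    have : 0 < W y := by
      rw [lintegral_pos_iff_support (by fun_prop)]
      have : (Function.support fun g : G => (w (g + s (-(g : G ⧸ H) + y)) : ℝ≥0∞)) = Set.univ := by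
        ext g
        simpa using (wpos _).ne'
      rw [this]
      exact (NeZero.pos _)
    exact this.ne'
  -- Taking `φ = 1` in the weighted identity gives `∫ W dλ = ∫ w dm < ∞`.
  have hWfin : ∀ᵐ y ∂lam, W y < ∞ := by
    refine ae_lt_top hW ?_
    have h1 := lintegral_weight_mul s hact m hw hσ (φ := 1) measurable_const
    simp only [Pi.one_apply, mul_one, lintegral_one, measure_univ] at h1
    rw [← hfst, lintegral_map hW measurable_fst]
    exact (h1.trans_lt (wint.trans ENNReal.one_lt_top)).ne
  have hcancel {ν : Measure ((G ⧸ H) × Z)} (hν : ν.map Prod.fst = lam) {A : Set ((G ⧸ H) × Z)}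
      (hA : MeasurableSet A) :
      ∫⁻ p, W p.1 * ((W p.1)⁻¹ * A.indicator 1 p) ∂ν = ν A := by
    rw [← lintegral_indicator_one hA]
    refine lintegral_congr_ae ?_
    rw [← hν] at hWfin
    filter_upwards [ae_of_ae_map measurable_fst.aemeasurable hWfin] with p hp
    rw [← mul_assoc, ENNReal.mul_inv_cancel (hW0 _) hp.ne, one_mul]
  ext A hA
  rw [← hcancel hfst hA, ← hcancel (ν := lam.prod (σ.map Prod.snd)) (by
    rw [Measure.map_fst_prod]; simp) hA]
  refine key ?_
  exact ((hW.comp measurable_fst).inv).mul (measurable_one.indicator hA)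

end Uniqueness

/-! ### Translations depending on a parameter -/

/-- A measure on `X × P` invariant under a group acting on the first coordinate is invariant under
translation of the first coordinate by a group element depending on the second coordinate. -/
theorem map_vadd_fst_of_invariant {Γ X P : Type*} [AddCommGroup Γ] [TopologicalSpace Γ]
    [IsTopologicalAddGroup Γ] [LocallyCompactSpace Γ] [SecondCountableTopology Γ]
    [MeasurableSpace Γ] [BorelSpace Γ] [MeasurableSpace X] [MeasurableSpace P]
    [AddAction Γ X] [MeasurableVAdd₂ Γ X]
    {κ : Measure (X × P)} [SFinite κ]
    (hκ : ∀ h : Γ, κ.map (fun q => (h +ᵥ q.1, q.2)) = κ) {k : P → Γ} (hk : Measurable k) :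
    κ.map (fun q => (k q.2 +ᵥ q.1, q.2)) = κ := by
  let m : Measure Γ := Measure.addHaar
  obtain ⟨w, wpos, wmeas, wint⟩ := exists_pos_lintegral_lt_of_sigmaFinite m one_ne_zero
  have hw : Measurable fun a => (w a : ℝ≥0∞) := wmeas.coe_nnreal_ennreal
  have hw0 : ∫⁻ h, (w h : ℝ≥0∞) ∂m ≠ 0 := by
    have : 0 < ∫⁻ h, (w h : ℝ≥0∞) ∂m := by
      rw [lintegral_pos_iff_support (by fun_prop)]
      have : (Function.support fun g : Γ => (w g : ℝ≥0∞)) = Set.univ := by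
        ext g
        simpa using (wpos _).ne'
      rw [this]
      exact (NeZero.pos _)
    exact this.ne'
  have hwt : ∫⁻ h, (w h : ℝ≥0∞) ∂m ≠ ∞ := (wint.trans ENNReal.one_lt_top).ne
  ext A hA
  let φ : X × P → ℝ≥0∞ := A.indicator 1
  have hφ : Measurable φ := measurable_one.indicator hA
  have hinv (ψ : X × P → ℝ≥0∞) (hψ : Measurable ψ) (h : Γ) :
      ∫⁻ q, ψ (h +ᵥ q.1, q.2) ∂κ = ∫⁻ q, ψ q ∂κ := by
    conv_rhs => rw [← hκ h]
    rw [lintegral_map hψ (by fun_prop)]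
  -- Invariance inserts a translation by `h`; a Haar substitution moves `k` out of the action into
  -- the weight; invariance then removes `h`, and translation invariance of Haar measure removes `k`
  -- from the weight.
  have key : (∫⁻ h, (w h : ℝ≥0∞) ∂m) * ∫⁻ q, φ (k q.2 +ᵥ q.1, q.2) ∂κ =
      (∫⁻ h, (w h : ℝ≥0∞) ∂m) * ∫⁻ q, φ q ∂κ := by
    calc _ = ∫⁻ h, w h * ∫⁻ q, φ (k q.2 +ᵥ (h +ᵥ q.1), q.2) ∂κ ∂m := by
          rw [← lintegral_mul_const _ hw]
          refine lintegral_congr fun h => ?_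
          rw [hinv (fun q => φ (k q.2 +ᵥ q.1, q.2)) (by fun_prop)]
      _ = ∫⁻ h, ∫⁻ q, w h * φ (k q.2 +ᵥ (h +ᵥ q.1), q.2) ∂κ ∂m :=
          lintegral_congr fun h => (lintegral_const_mul _ (by fun_prop)).symm
      _ = ∫⁻ q, ∫⁻ h, w h * φ (k q.2 +ᵥ (h +ᵥ q.1), q.2) ∂m ∂κ :=
          lintegral_lintegral_swap (Measurable.aemeasurable (by fun_prop))
      _ = ∫⁻ q, ∫⁻ h, w (-k q.2 + h) * φ (h +ᵥ q.1, q.2) ∂m ∂κ := by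
          refine lintegral_congr fun q => ?_
          rw [← lintegral_add_left_eq_self
            (fun h => (w (-k q.2 + h) : ℝ≥0∞) * φ (h +ᵥ q.1, q.2)) (k q.2)]
          simp [add_vadd]
      _ = ∫⁻ h, ∫⁻ q, w (-k q.2 + h) * φ (h +ᵥ q.1, q.2) ∂κ ∂m :=
          lintegral_lintegral_swap (Measurable.aemeasurable (by fun_prop))
      _ = ∫⁻ h, ∫⁻ q, w (-k q.2 + h) * φ q ∂κ ∂m :=
          lintegral_congr fun h => hinv (fun q => w (-k q.2 + h) * φ q) (by fun_prop) h
      _ = ∫⁻ q, ∫⁻ h, w (-k q.2 + h) * φ q ∂m ∂κ :=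
          lintegral_lintegral_swap (Measurable.aemeasurable (by fun_prop))
      _ = ∫⁻ q, (∫⁻ h, (w h : ℝ≥0∞) ∂m) * φ q ∂κ := by
          refine lintegral_congr fun q => ?_
          rw [lintegral_mul_const _ (by fun_prop),
            lintegral_add_left_eq_self (fun h => (w h : ℝ≥0∞)) (-k q.2)]
      _ = _ := lintegral_const_mul _ hφ
  have := (ENNReal.mul_right_inj hw0 hwt).1 key
  rw [← lintegral_indicator_one hA, ← lintegral_indicator_one hA, lintegral_map hφ (by fun_prop)]
  exact this

theorem measurePreserving_vadd_of_invariant {Γ X P Y : Type*} [AddCommGroup Γ] [TopologicalSpace Γ]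
    [IsTopologicalAddGroup Γ] [LocallyCompactSpace Γ] [SecondCountableTopology Γ]
    [MeasurableSpace Γ] [BorelSpace Γ] [MeasurableSpace X] [MeasurableSpace P] [MeasurableSpace Y]
    [AddAction Γ X] [MeasurableVAdd₂ Γ X] (lam : Measure Y) [SFinite lam]
    {κ : Measure (X × P)} [SFinite κ]
    (hκ : ∀ h : Γ, κ.map (fun q => (h +ᵥ q.1, q.2)) = κ) {k : Y × P → Γ} (hk : Measurable k) :
    MeasurePreserving (fun q : Y × (X × P) => (q.1, (k (q.1, q.2.2) +ᵥ q.2.1, q.2.2)))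
      (lam.prod κ) (lam.prod κ) := by
  refine (MeasurePreserving.id lam).skew_product
    (g := fun y (q : X × P) => (k (y, q.2) +ᵥ q.1, q.2)) ?_ (Filter.Eventually.of_forall fun y => ?_)
  · change Measurable fun q : Y × (X × P) => (k (q.1, q.2.2) +ᵥ q.2.1, q.2.2)
    fun_prop
  · exact map_vadd_fst_of_invariant hκ (hk.comp measurable_prodMk_left)

theorem MeasurableEq.prod {α β : Type*} [MeasurableSpace α] [MeasurableSpace β] [MeasurableEq α]
    [MeasurableEq β] : MeasurableEq (α × β) where
  measurableSet_diagonal := by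
    have h : Set.diagonal (α × β) = {p | p.1.1 = p.2.1} ∩ {p | p.1.2 = p.2.2} := by
      ext p
      simp [Prod.ext_iff]
    rw [h]
    exact (measurableSet_eq_fun (by fun_prop) (by fun_prop)).inter
      (measurableSet_eq_fun (by fun_prop) (by fun_prop))

theorem MeasurableConstVAdd.prod {Γ α β : Type*} [MeasurableSpace α] [MeasurableSpace β]
    [VAdd Γ α] [VAdd Γ β] [MeasurableConstVAdd Γ α] [MeasurableConstVAdd Γ β] :
    MeasurableConstVAdd Γ (α × β) where
  measurable_const_vadd c := (measurable_fst.const_vadd c).prodMk (measurable_snd.const_vadd c)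

/-! ### Joinings concentrated on graphs -/

section Graph

variable {Γ α β : Type*} [MeasurableSpace α] [MeasurableSpace β] [VAdd Γ α] [VAdd Γ β]
  [MeasurableConstVAdd Γ α] [MeasurableConstVAdd Γ β] {μ : Measure α} {ν : Measure β}

/-- An invariant joining that is concentrated on the graph of a map in both directions is the graph
of an isomorphism. -/
theorem isActionIso_of_ae_eq [MeasurableEq α] [MeasurableEq β] {κ : Measure (α × β)}
    (hfst : κ.map Prod.fst = μ) (hsnd : κ.map Prod.snd = ν)
    (hinv : ∀ γ : Γ, κ.map (fun p => γ +ᵥ p) = κ) {R : α → β} {R' : β → α}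
    (hR : Measurable R) (hR' : Measurable R') (hgR : ∀ᵐ p ∂κ, p.2 = R p.1)
    (hgR' : ∀ᵐ p ∂κ, p.1 = R' p.2) :
    IsActionIso Γ μ ν R ∧ κ = μ.map (fun x => (x, R x)) := by
  have hgraph : κ = μ.map (fun x => (x, R x)) := by
    rw [← hfst, Measure.map_map (by fun_prop) measurable_fst]
    conv_lhs => rw [← Measure.map_id (μ := κ)]
    refine Measure.map_congr ?_
    filter_upwards [hgR] with p hp
    exact Prod.ext rfl hp
  refine ⟨⟨⟨hR, ?_⟩, ⟨R', ⟨hR', ?_⟩, ?_, ?_⟩, fun γ => ?_⟩, hgraph⟩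
  · rw [← hfst, ← hsnd, Measure.map_map hR measurable_fst]
    refine Measure.map_congr ?_
    filter_upwards [hgR] with p hp using hp.symm
  · rw [← hfst, ← hsnd, Measure.map_map hR' measurable_snd]
    refine Measure.map_congr ?_
    filter_upwards [hgR'] with p hp using hp.symm
  · rw [← hfst]
    refine (ae_map_iff (p := fun x => R' (R x) = x) measurable_fst.aemeasurable
      (measurableSet_eq_fun (hR'.comp hR) measurable_id)).2 ?_
    filter_upwards [hgR, hgR'] with p h1 h2
    rw [← h1, ← h2]
  · rw [← hsnd]
    refine (ae_map_iff (p := fun y => R (R' y) = y) measurable_snd.aemeasurable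
      (measurableSet_eq_fun (hR.comp hR') measurable_id)).2 ?_
    filter_upwards [hgR, hgR'] with p h1 h2
    rw [← h2, ← h1]
  · rw [← hfst]
    refine (ae_map_iff (p := fun x => R (γ +ᵥ x) = γ +ᵥ R x) measurable_fst.aemeasurable
      (measurableSet_eq_fun (hR.comp (measurable_const_vadd γ)) (hR.const_vadd γ))).2 ?_
    have : MeasurableConstVAdd Γ (α × β) := MeasurableConstVAdd.prod
    -- Invariance of `κ` gives the graph relation at `γ +ᵥ p` as well as at `p`; comparing the two
    -- yields equivariance.
    have hg' : ∀ᵐ p ∂κ.map (fun p => γ +ᵥ p), p.2 = R p.1 := by rwa [hinv]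
    filter_upwards [hgR, ae_of_ae_map (measurable_const_vadd γ).aemeasurable hg'] with p h1 h2
    rw [← h1]
    exact h2.symm

theorem IsActionIso.ae_eq_graph [MeasurableEq α] [MeasurableEq β] {φ : α → β}
    (h : IsActionIso Γ μ ν φ) :
    (μ.map (fun x => (x, φ x))).map Prod.fst = μ ∧ (μ.map (fun x => (x, φ x))).map Prod.snd = ν ∧
    (∀ᵐ p ∂μ.map (fun x => (x, φ x)), p.2 = φ p.1) ∧
    ∃ ψ : β → α, Measurable ψ ∧ ∀ᵐ p ∂μ.map (fun x => (x, φ x)), p.1 = ψ p.2 := by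
  obtain ⟨hφ, ⟨ψ, hψ, h1, h2⟩, -⟩ := h
  have hm : Measurable fun x => (x, φ x) := measurable_id.prodMk hφ.measurable
  refine ⟨?_, ?_, ?_, ψ, hψ.measurable, ?_⟩
  · rw [Measure.map_map measurable_fst hm]
    exact Measure.map_id
  · rw [Measure.map_map measurable_snd hm]
    exact hφ.map_eq
  · refine (ae_map_iff (p := fun p : α × β => p.2 = φ p.1) hm.aemeasurable
      (measurableSet_eq_fun measurable_snd (hφ.measurable.comp measurable_fst))).2 ?_
    exact Filter.Eventually.of_forall fun x => rfl
  · refine (ae_map_iff (p := fun p : α × β => p.1 = ψ p.2) hm.aemeasurable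
      (measurableSet_eq_fun measurable_fst (hψ.measurable.comp measurable_snd))).2 ?_
    filter_upwards [h1] with x hx using hx.symm

theorem IsActionIso.map_vadd_graph {φ : α → β} (h : IsActionIso Γ μ ν φ)
    [VAddInvariantMeasure Γ α μ] (γ : Γ) :
    (μ.map (fun x => (x, φ x))).map (fun p => γ +ᵥ p) = μ.map (fun x => (x, φ x)) := by
  have : MeasurableConstVAdd Γ (α × β) := MeasurableConstVAdd.prod
  have hm : Measurable fun x => (x, φ x) := measurable_id.prodMk h.1.measurable
  conv_rhs => rw [← MeasureTheory.map_vadd γ μ]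
  rw [Measure.map_map (measurable_const_vadd γ) hm, Measure.map_map hm (measurable_const_vadd γ)]
  refine Measure.map_congr ?_
  filter_upwards [h.2.2 γ] with x hx
  exact Prod.ext rfl hx.symm

end Graph

/-! ### Coordinates straightening the diagonal action -/

section Untwist

variable {G : Type*} [AddCommGroup G] [MeasurableSpace G] {H : AddSubgroup G}
  {X X' : Type*} [AddAction H X] [AddAction H X']

/-- The action of `H` on `(X × X') × G/H` that is diagonal on `X × X'` and trivial on `G/H`. -/
def actDiag (h : H) (q : (X × X') × (G ⧸ H)) : (X × X') × (G ⧸ H) :=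
  ((h +ᵥ q.1.1, h +ᵥ q.1.2), q.2)

/-- Records a pair of points of the induced spaces by the first base point, the fibre coordinates
(the second one moved back to the first fibre) and the difference of the base points. -/
def untwist (s : BorelSection H) (p : Induced s X × Induced s X') :
    (G ⧸ H) × ((X × X') × (G ⧸ H)) :=
  (p.1.1, ((p.1.2, -s.cocycle (s p.1.1) (-p.1.1 + p.2.1) +ᵥ p.2.2), -p.1.1 + p.2.1))

/-- The inverse of `untwist`. -/
def twist (s : BorelSection H) (q : (G ⧸ H) × ((X × X') × (G ⧸ H))) :
    Induced s X × Induced s X' :=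
  (Induced.mk s q.1 q.2.1.1, Induced.mk s (q.2.2 + q.1) (s.cocycle (s q.1) q.2.2 +ᵥ q.2.1.2))

theorem twist_untwist (s : BorelSection H) (p : Induced s X × Induced s X') :
    twist s (untwist s p) = p := by
  refine Prod.ext rfl (Prod.ext ?_ ?_)
  · change -p.1.1 + p.2.1 + p.1.1 = p.2.1
    abel
  · exact vadd_neg_vadd _ _

theorem untwist_twist (s : BorelSection H) (q : (G ⧸ H) × ((X × X') × (G ⧸ H))) :
    untwist s (twist s q) = q := by
  have h : -q.1 + (q.2.2 + q.1) = q.2.2 := by abel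
  refine Prod.ext rfl (Prod.ext (Prod.ext rfl ?_) h)
  change -s.cocycle (s q.1) (-q.1 + (q.2.2 + q.1)) +ᵥ (s.cocycle (s q.1) q.2.2 +ᵥ q.2.1.2) = q.2.1.2
  rw [h, neg_vadd_vadd]

theorem twist_skewMap (s : BorelSection H) (g : G) (q : (G ⧸ H) × ((X × X') × (G ⧸ H))) :
    twist s (skewMap s actDiag g q) = g +ᵥ twist s q := by
  obtain ⟨y, ⟨x, x'⟩, c⟩ := q
  refine Prod.ext rfl (Prod.ext ?_ ?_)
  · change c + (g + y) = g + (c + y)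
    abel
  · change s.cocycle (s (g + y)) c +ᵥ (s.cocycle g y +ᵥ x') =
      s.cocycle g (c + y) +ᵥ (s.cocycle (s y) c +ᵥ x')
    rw [← add_vadd, ← add_vadd, add_comm c y, s.cocycle_add_cocycle_section]

theorem untwist_vadd (s : BorelSection H) (g : G) (p : Induced s X × Induced s X') :
    untwist s (g +ᵥ p) = skewMap s actDiag g (untwist s p) := by
  rw [← untwist_twist s (skewMap s actDiag g (untwist s p)), twist_skewMap, twist_untwist]

end Untwist

/-! ### Invariant joinings of induced actions and their marginals -/

section Joinings

variable {G : Type*} [AddCommGroup G] [TopologicalSpace G] [IsTopologicalAddGroup G]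
  [SecondCountableTopology G] [MeasurableSpace G] [BorelSpace G] {H : AddSubgroup G}
  {X X' : Type*} [AddAction H X] [AddAction H X'] [MeasurableSpace X] [MeasurableSpace X']
  [MeasurableVAdd₂ H X] [MeasurableVAdd₂ H X']

theorem measurable_actDiag :
    Measurable (Function.uncurry (actDiag : H → (X × X') × (G ⧸ H) → (X × X') × (G ⧸ H))) := by
  change Measurable fun p : H × ((X × X') × (G ⧸ H)) => ((p.1 +ᵥ p.2.1.1, p.1 +ᵥ p.2.1.2), p.2.2)
  fun_prop

theorem measurable_vadd_uncurry : Measurable (Function.uncurry fun (h : H) (x : X) => h +ᵥ x) := by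
  change Measurable fun p : H × X => p.1 +ᵥ p.2
  fun_prop

theorem measurable_untwist (s : BorelSection H) :
    Measurable (untwist s : Induced s X × Induced s X' → _) := by
  have := s.measurableAdd₂
  have := s.measurableNeg
  have hs := s.measurable_toFun
  have hc := s.measurable_cocycle
  have hc' : Measurable fun p : ((G ⧸ H) × X) × ((G ⧸ H) × X') =>
      s.cocycle (s p.1.1) (-p.1.1 + p.2.1) :=
    hc.comp (Measurable.prodMk (by fun_prop) (by fun_prop))
  change Measurable fun p : ((G ⧸ H) × X) × ((G ⧸ H) × X') =>
    (p.1.1, ((p.1.2, -s.cocycle (s p.1.1) (-p.1.1 + p.2.1) +ᵥ p.2.2), -p.1.1 + p.2.1))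
  fun_prop

theorem measurable_twist (s : BorelSection H) :
    Measurable (twist s : _ → Induced s X × Induced s X') := by
  have := s.measurableAdd₂
  have hs := s.measurable_toFun
  have hc := s.measurable_cocycle
  have hc' : Measurable fun q : (G ⧸ H) × ((X × X') × (G ⧸ H)) => s.cocycle (s q.1) q.2.2 :=
    hc.comp (Measurable.prodMk (by fun_prop) (by fun_prop))
  change Measurable fun q : (G ⧸ H) × ((X × X') × (G ⧸ H)) =>
    (((q.1, q.2.1.1), (q.2.2 + q.1, s.cocycle (s q.1) q.2.2 +ᵥ q.2.1.2)) :
      ((G ⧸ H) × X) × ((G ⧸ H) × X'))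
  fun_prop

theorem measurableConstVAdd_induced (s : BorelSection H) :
    MeasurableConstVAdd G (Induced s X) where
  measurable_const_vadd g :=
    measurable_skewMap_apply s measurable_vadd_uncurry g

theorem vaddInvariantMeasure_induced (s : BorelSection H) (lam : Measure (G ⧸ H))
    [lam.IsAddLeftInvariant] [SFinite lam] (μ : Measure X) [SFinite μ]
    [VAddInvariantMeasure H X μ] :
    VAddInvariantMeasure G (Induced s X) (Induced.measure s lam μ) where
  measure_preimage_vadd g A hA := by
    have := measurableConstVAdd_induced (X := X) s
    conv_rhs => rw [Induced.measure, ← map_skewMap_prod s measurable_vadd_uncurry lam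
      (fun h => MeasureTheory.map_vadd h μ) g]
    exact (Measure.map_apply (measurable_const_vadd g) hA).symm

/-- Data extracted from an invariant measure on the product of two induced spaces. -/
theorem exists_map_untwist_eq_prod [LocallyCompactSpace G] [T2Space G] (s : BorelSection H)
    (lam : Measure (G ⧸ H)) [lam.IsAddLeftInvariant] [IsProbabilityMeasure lam]
    (μ : Measure X) [IsProbabilityMeasure μ] {ρ : Measure (Induced s X × Induced s X')}
    (hfst : ρ.map Prod.fst = Induced.measure s lam μ)
    (hinv : ∀ g : G, ρ.map (fun p => g +ᵥ p) = ρ) :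
    ∃ κ : Measure ((X × X') × (G ⧸ H)), IsProbabilityMeasure κ ∧
      (∀ h : H, κ.map (actDiag h) = κ) ∧ κ.map (fun q => q.1.1) = μ ∧
      ρ.map (untwist s) = lam.prod κ ∧ ρ = (lam.prod κ).map (twist s) := by
  have hu := measurable_untwist (X := X) (X' := X') s
  have ht := measurable_twist (X := X) (X' := X') s
  have := measurableConstVAdd_induced (X := X) s
  have := measurableConstVAdd_induced (X := X') s
  have : MeasurableConstVAdd G (Induced s X × Induced s X') := MeasurableConstVAdd.prod
  have hσ (g : G) : (ρ.map (untwist s)).map (skewMap s actDiag g) = ρ.map (untwist s) := by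
    conv_rhs => rw [← hinv g]
    rw [Measure.map_map (measurable_skewMap_apply s measurable_actDiag g) hu,
      Measure.map_map hu (measurable_const_vadd g)]
    congr 1
    ext1 p
    exact (untwist_vadd s g p).symm
  have hf : (ρ.map (untwist s)).map Prod.fst = lam := by
    rw [Measure.map_map measurable_fst hu]
    have h1 : (ρ.map Prod.fst).map (Prod.fst : (G ⧸ H) × X → G ⧸ H) = lam := by
      rw [hfst]
      exact (Measure.map_fst_prod (μ := lam) (ν := μ)).trans (by simp)
    rw [← h1]
    exact (Measure.map_map measurable_fst measurable_fst).symm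
  have hprod := eq_prod_of_map_skewMap s measurable_actDiag lam hσ hf
  have hprob : IsProbabilityMeasure (ρ.map (untwist s)) := by
    have : IsProbabilityMeasure ((ρ.map (untwist s)).map Prod.fst) := by rw [hf]; infer_instance
    exact Measure.isProbabilityMeasure_of_map Prod.fst
  refine ⟨(ρ.map (untwist s)).map Prod.snd,
    Measure.isProbabilityMeasure_map measurable_snd.aemeasurable,
    map_act_snd s measurable_actDiag hσ, ?_, hprod, ?_⟩
  · rw [Measure.map_map (by fun_prop) measurable_snd, Measure.map_map (by fun_prop) hu]
    have h1 : (ρ.map Prod.fst).map (Prod.snd : (G ⧸ H) × X → X) = μ := by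
      rw [hfst]
      exact (Measure.map_snd_prod (μ := lam) (ν := μ)).trans (by simp)
    rw [← h1]
    exact (Measure.map_map measurable_snd measurable_fst).symm
  · rw [← hprod, Measure.map_map ht hu]
    conv_lhs => rw [← Measure.map_id (μ := ρ)]
    congr 1
    ext1 p
    exact (twist_untwist s p).symm

theorem map_second_coord (s : BorelSection H) (lam : Measure (G ⧸ H)) [IsProbabilityMeasure lam]
    {μ' : Measure X'} [IsProbabilityMeasure μ'] {ρ : Measure (Induced s X × Induced s X')}
    (hsnd : ρ.map Prod.snd = Induced.measure s lam μ') :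
    ρ.map (fun p => p.2.2) = μ' := by
  have h1 : (ρ.map Prod.snd).map (Prod.snd : (G ⧸ H) × X' → X') = μ' := by
    rw [hsnd]
    exact (Measure.map_snd_prod (μ := lam) (ν := μ')).trans (by simp)
  rw [← h1]
  exact (Measure.map_map measurable_snd measurable_snd).symm

/-- Moving the second fibre coordinate back to the first fibre does not change its joint law with
the difference of the base points. -/
theorem map_untwist_snd [LocallyCompactSpace G] [T2Space G] (hH : IsClosed (H : Set G))
    (s : BorelSection H)
    (lam : Measure (G ⧸ H)) [lam.IsAddLeftInvariant] [IsProbabilityMeasure lam]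
    {μ' : Measure X'} [IsProbabilityMeasure μ'] {ρ : Measure (Induced s X × Induced s X')}
    (hsnd : ρ.map Prod.snd = Induced.measure s lam μ')
    (hinv : ∀ g : G, ρ.map (fun p => g +ᵥ p) = ρ) :
    ρ.map (fun p => ((untwist s p).2.1.2, (untwist s p).2.2)) =
      ρ.map (fun p => (p.2.2, -p.1.1 + p.2.1)) ∧
    ρ.map (fun p => (p.2.1, (p.2.2, -p.1.1 + p.2.1))) =
      lam.prod (ρ.map (fun p => (p.2.2, -p.1.1 + p.2.1))) := by
  have := s.measurableAdd₂
  have := s.measurableNeg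
  have hs := s.measurable_toFun
  have hu := measurable_untwist (X := X) (X' := X') s
  have := measurableConstVAdd_induced (X := X) s
  have := measurableConstVAdd_induced (X := X') s
  have : MeasurableConstVAdd G (Induced s X × Induced s X') := MeasurableConstVAdd.prod
  have : SecondCountableTopology H :=
    TopologicalSpace.Subtype.secondCountableTopology (H : Set G)
  have : LocallyCompactSpace H := hH.isClosedEmbedding_subtypeVal.locallyCompactSpace
  let act : H → X' × (G ⧸ H) → X' × (G ⧸ H) := fun h q => (h +ᵥ q.1, q.2)
  have hact : Measurable (Function.uncurry act) := by
    change Measurable fun p : H × (X' × (G ⧸ H)) => (p.1 +ᵥ p.2.1, p.2.2)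
    fun_prop
  -- The same pair seen from its second base point: here `x₂` needs no transport, and the difference
  -- is again fixed by the action.
  let f : Induced s X × Induced s X' → (G ⧸ H) × (X' × (G ⧸ H)) :=
    fun p => (p.2.1, (p.2.2, -p.1.1 + p.2.1))
  have hf : Measurable f := by
    change Measurable fun p : ((G ⧸ H) × X) × ((G ⧸ H) × X') =>
      (p.2.1, (p.2.2, -p.1.1 + p.2.1))
    fun_prop
  have hσ (g : G) : (ρ.map f).map (skewMap s act g) = ρ.map f := by
    conv_rhs => rw [← hinv g]
    rw [Measure.map_map (measurable_skewMap_apply s hact g) hf,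
      Measure.map_map hf (measurable_const_vadd g)]
    congr 1
    ext1 p
    refine Prod.ext rfl (Prod.ext rfl ?_)
    change -p.1.1 + p.2.1 = -(g + p.1.1) + (g + p.2.1)
    abel
  have hf1 : (ρ.map f).map Prod.fst = lam := by
    rw [Measure.map_map measurable_fst hf]
    have h1 : (ρ.map Prod.snd).map (Prod.fst : (G ⧸ H) × X' → G ⧸ H) = lam := by
      rw [hsnd]
      exact (Measure.map_fst_prod (μ := lam) (ν := μ')).trans (by simp)
    rw [← h1]
    exact (Measure.map_map measurable_fst measurable_snd).symm
  have hprod := eq_prod_of_map_skewMap s hact lam hσ hf1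
  have hprob : IsProbabilityMeasure (ρ.map f) := by
    have : IsProbabilityMeasure ((ρ.map f).map Prod.fst) := by rw [hf1]; infer_instance
    exact Measure.isProbabilityMeasure_of_map Prod.fst
  have hκ := map_act_snd s hact hσ
  have hsndf : (ρ.map f).map Prod.snd = ρ.map (fun p => (p.2.2, -p.1.1 + p.2.1)) :=
    Measure.map_map measurable_snd hf
  refine ⟨?_, hsndf ▸ hprod⟩
  rw [← hsndf]
  set κ := (ρ.map f).map Prod.snd with hκdef
  have : IsProbabilityMeasure κ := Measure.isProbabilityMeasure_map measurable_snd.aemeasurable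
  -- The first base point is `-c + y₂`, so the transport back depends only on `(y₂, c)`, and such a
  -- translation preserves `λ × κ`.
  have hpres : MeasurePreserving (fun q : (G ⧸ H) × (X' × (G ⧸ H)) =>
      (q.1, (-s.cocycle (s (-q.2.2 + q.1)) q.2.2 +ᵥ q.2.1, q.2.2))) (lam.prod κ) (lam.prod κ) :=
    measurePreserving_vadd_of_invariant lam (k := fun p => -s.cocycle (s (-p.2 + p.1)) p.2) hκ
      (s.measurable_cocycle.comp (Measurable.prodMk (by fun_prop) (by fun_prop))).neg
  calc _ = ((ρ.map f).map (fun q : (G ⧸ H) × (X' × (G ⧸ H)) =>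
      (q.1, (-s.cocycle (s (-q.2.2 + q.1)) q.2.2 +ᵥ q.2.1, q.2.2)))).map Prod.snd := by
        rw [Measure.map_map measurable_snd hpres.measurable,
          Measure.map_map (measurable_snd.comp hpres.measurable) hf]
        congr 1
        ext1 p
        simp [f, untwist]
    _ = (lam.prod κ).map Prod.snd := by rw [hprod, hpres.map_eq]
    _ = κ := by rw [Measure.map_snd_prod]; simp

theorem map_untwist_snd_fst [LocallyCompactSpace G] [T2Space G] (hH : IsClosed (H : Set G))
    (s : BorelSection H)
    (lam : Measure (G ⧸ H)) [lam.IsAddLeftInvariant] [IsProbabilityMeasure lam]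
    {μ' : Measure X'} [IsProbabilityMeasure μ'] {ρ : Measure (Induced s X × Induced s X')}
    (hsnd : ρ.map Prod.snd = Induced.measure s lam μ')
    (hinv : ∀ g : G, ρ.map (fun p => g +ᵥ p) = ρ) :
    ρ.map (fun p => (untwist s p).2.1.2) = μ' := by
  have := s.measurableAdd₂
  have := s.measurableNeg
  have hu := measurable_untwist (X := X) (X' := X') s
  have h1 : Measurable fun p : Induced s X × Induced s X' => (p.2.2, -p.1.1 + p.2.1) := by
    change Measurable fun p : ((G ⧸ H) × X) × ((G ⧸ H) × X') => (p.2.2, -p.1.1 + p.2.1)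
    fun_prop
  have h2 : Measurable fun p : Induced s X × Induced s X' =>
      ((untwist s p).2.1.2, (untwist s p).2.2) :=
    (show Measurable fun q : (G ⧸ H) × ((X × X') × (G ⧸ H)) => (q.2.1.2, q.2.2) by
      fun_prop).comp hu
  have h := congrArg (Measure.map Prod.fst) (map_untwist_snd hH s lam hsnd hinv).1
  rw [Measure.map_map measurable_fst h1, Measure.map_map measurable_fst h2] at h
  exact h.trans (map_second_coord s lam hsnd)

end Joinings

/-- Reduces the graph property to measurable dependence of each coordinate on the other, a condition
that passes to fibres. -/
theorem isGraphOfIso_iff {Γ α : Type*} [MeasurableSpace α] [VAdd Γ α] [MeasurableConstVAdd Γ α]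
    [MeasurableEq α] {μ : Measure α} {κ : Measure (α × α)}
    (hfst : κ.map Prod.fst = μ) (hsnd : κ.map Prod.snd = μ)
    (hinv : ∀ γ : Γ, κ.map (fun p => γ +ᵥ p) = κ) :
    IsGraphOfIso Γ μ κ ↔ (∃ R : α → α, Measurable R ∧ ∀ᵐ p ∂κ, p.2 = R p.1) ∧
      ∃ R : α → α, Measurable R ∧ ∀ᵐ p ∂κ, p.1 = R p.2 := by
  constructor
  · rintro ⟨R, hR, rfl⟩
    obtain ⟨-, -, h1, h2⟩ := hR.ae_eq_graph
    exact ⟨⟨R, hR.1.measurable, h1⟩, h2⟩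
  · rintro ⟨⟨R, hR, h1⟩, R', hR', h2⟩
    obtain ⟨h3, h4⟩ := isActionIso_of_ae_eq hfst hsnd hinv hR hR' h1 h2
    exact ⟨R, h3, h4⟩

/-! ### The integral formula, ergodicity and graphs -/

section

variable {G : Type*} [AddCommGroup G] [TopologicalSpace G] [IsTopologicalAddGroup G]
  [SecondCountableTopology G] [MeasurableSpace G] [BorelSpace G] {H : AddSubgroup G}
  {X X' : Type*} [AddAction H X] [AddAction H X'] [MeasurableSpace X] [MeasurableSpace X']
  [MeasurableVAdd₂ H X] [MeasurableVAdd₂ H X']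

/-- The inverse of `untwist` on pairs of points with a given difference of the base points. -/
def twistAt (s : BorelSection H) (c : G ⧸ H) (q : (G ⧸ H) × (X × X')) :
    Induced s X × Induced s X' :=
  twist s (q.1, (q.2, c))

theorem measurable_twistAt (s : BorelSection H) (c : G ⧸ H) :
    Measurable (twistAt s c : _ → Induced s X × Induced s X') :=
  (measurable_twist s).comp (by fun_prop)

/-- Since `s 0 = 0`, the cocycle `h(s(y), H)` vanishes, so the integrand at `y` is the image of `κ`
under `twistAt` with first base point `y`; the rest is Fubini. -/
theorem isIntegralOfFibres_iff (s : BorelSection H) (lam : Measure (G ⧸ H)) [SFinite lam]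
    (κ : Measure (X × X)) [SFinite κ] (g : G) (ρ : Measure (Induced s X × Induced s X)) :
    IsIntegralOfFibres s lam κ g ρ ↔ ρ = (lam.prod κ).map (twistAt s (g : G ⧸ H)) := by
  have hT := measurable_twistAt (X := X) (X' := X) s (g : G ⧸ H)
  have key (y : G ⧸ H) : ((fibreMeasure s κ g y).prod
      ((Measure.dirac y).prod (Measure.dirac ((g : G ⧸ H) + y)))).map
      (fun q => (Induced.mk s q.2.1 q.1.1, Induced.mk s q.2.2 q.1.2)) =
      κ.map (fun p => twistAt s (g : G ⧸ H) (y, p)) := by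
    have hm : Measurable fun q : (X × X) × ((G ⧸ H) × (G ⧸ H)) =>
        (Induced.mk s q.2.1 q.1.1, Induced.mk s q.2.2 q.1.2) := by
      change Measurable fun q : (X × X) × ((G ⧸ H) × (G ⧸ H)) =>
        (((q.2.1, q.1.1), (q.2.2, q.1.2)) : ((G ⧸ H) × X) × ((G ⧸ H) × X))
      fun_prop
    have : SFinite (fibreMeasure s κ g y) := by
      unfold fibreMeasure
      infer_instance
    rw [Measure.dirac_prod_dirac, Measure.prod_dirac, Measure.map_map hm (by fun_prop),
      fibreMeasure, Measure.map_map (hm.comp (by fun_prop)) (by fun_prop)]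
    congr 1
    ext1 p
    simp [s.cocycle_section_zero, twistAt, twist]
  have hA (A : Set (Induced s X × Induced s X)) (h : MeasurableSet A) :
      (lam.prod κ).map (twistAt s (g : G ⧸ H)) A =
        ∫⁻ y, κ.map (fun p => twistAt s (g : G ⧸ H) (y, p)) A ∂lam := by
    rw [Measure.map_apply hT h, Measure.prod_apply (hT h)]
    refine lintegral_congr fun y => ?_
    exact (Measure.map_apply (hT.comp measurable_prodMk_left) h).symm
  simp only [IsIntegralOfFibres, key]
  constructor
  · intro h
    ext A hA'
    rw [h A hA', hA A hA']
  · rintro rfl A hA'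
    exact hA A hA'

/-- For an ergodic joining of induced actions the difference of the base points is constant. -/
theorem exists_ae_sub_eq [T2Space G] (s : BorelSection H)
    {ρ : Measure (Induced s X × Induced s X')}
    (h : ErgodicVAdd G (Induced s X × Induced s X') ρ) :
    ∃ g : G, ∀ᵐ p ∂ρ, -p.1.1 + p.2.1 = (g : G ⧸ H) := by
  have := s.measurableAdd₂
  have := s.measurableNeg
  have hs := s.measurable_toFun
  -- The section lifts the difference to `G`, whose Borel sets are countably separated. Preimages of
  -- Borel sets are invariant, hence null or conull, so `f` is a.e. constant.
  let f : Induced s X × Induced s X' → G := fun p => s (-p.1.1 + p.2.1)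
  have hf : Measurable f := by
    change Measurable fun p : ((G ⧸ H) × X) × ((G ⧸ H) × X') => s (-p.1.1 + p.2.1)
    fun_prop
  obtain ⟨g, hg⟩ := Filter.exists_eventuallyEq_const_of_forall_separating (l := ae ρ) (f := f)
    MeasurableSet fun U hU => by
      refine Filter.eventuallyConst_set.1 (h.aeconst_of_forall_preimage_vadd_ae_eq (hf hU)
        fun g => ?_)
      refine Filter.EventuallyEq.of_eq ?_
      refine Set.ext fun p => ?_
      have : f (g +ᵥ p) = f p := by
        change s (-(g + p.1.1) + (g + p.2.1)) = s (-p.1.1 + p.2.1)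
        congr 1
        abel
      exact iff_of_eq (congrArg (· ∈ U) this)
  refine ⟨g, ?_⟩
  filter_upwards [hg] with p hp
  rw [← s.mk_toFun (-p.1.1 + p.2.1)]
  exact congrArg _ hp

theorem exists_ergodic_fibre_joining [LocallyCompactSpace G] [T2Space G]
    (hH : IsClosed (H : Set G)) (s : BorelSection H)
    (lam : Measure (G ⧸ H)) [lam.IsAddLeftInvariant] [IsProbabilityMeasure lam]
    (μ : Measure X) [IsProbabilityMeasure μ] {ρ : Measure (Induced s X × Induced s X)}
    (hρ : IsErgodicSelfJoining G (Induced.measure s lam μ) ρ) :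
    ∃ (κ : Measure (X × X)) (g : G), IsProbabilityMeasure κ ∧ IsErgodicSelfJoining H μ κ ∧
      ρ = (lam.prod κ).map (twistAt s (g : G ⧸ H)) ∧
      ActionIsomorphic G ρ (Induced.measure s lam κ) := by
  have := s.measurableEq
  have := measurableConstVAdd_induced (X := X) s
  have : MeasurableConstVAdd G (Induced s X × Induced s X) := MeasurableConstVAdd.prod
  have : MeasurableConstVAdd H (X × X) := MeasurableConstVAdd.prod
  have hu := measurable_untwist (X := X) (X' := X) s
  have ht := measurable_twist (X := X) (X' := X) s
  have herg := hρ.ergodic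
  have hinv (g : G) : ρ.map (fun p => g +ᵥ p) = ρ := MeasureTheory.map_vadd g ρ
  obtain ⟨g, hg⟩ := exists_ae_sub_eq s herg
  obtain ⟨κ', hprob, hκ', hfst, huntw, htw⟩ := exists_map_untwist_eq_prod s lam μ hρ.map_fst hinv
  have hsnd : κ'.map (fun q => q.1.2) = μ := by
    have h1 : (lam.prod κ').map Prod.snd = κ' := by rw [Measure.map_snd_prod]; simp
    conv_lhs => rw [← h1, ← huntw, Measure.map_map measurable_snd hu,
      Measure.map_map (by fun_prop) (measurable_snd.comp hu)]
    exact map_untwist_snd_fst hH s lam hρ.map_snd hinv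
  have hc : ∀ᵐ q ∂κ', q.2 = (g : G ⧸ H) := by
    have h1 : ∀ᵐ q ∂(lam.prod κ'), q.2.2 = (g : G ⧸ H) := by
      rw [← huntw]
      refine (ae_map_iff (p := fun q => q.2.2 = (g : G ⧸ H)) hu.aemeasurable
        (measurableSet_eq_fun (by fun_prop) (by fun_prop))).2 ?_
      exact hg
    exact (Measure.ae_ae_of_ae_prod h1).exists.choose_spec
  let κ := κ'.map Prod.fst
  have hκprob : IsProbabilityMeasure κ := Measure.isProbabilityMeasure_map measurable_fst.aemeasurable
  -- The constant difference makes `κ'` the product of `κ` with a point mass.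
  have hκκ' : κ.map (fun p => (p, (g : G ⧸ H))) = κ' := by
    rw [Measure.map_map (by fun_prop) measurable_fst]
    conv_rhs => rw [← Measure.map_id (μ := κ')]
    refine Measure.map_congr ?_
    filter_upwards [hc] with q hq
    exact Prod.ext rfl hq.symm
  have hκinv (h : H) : κ.map (fun p => h +ᵥ p) = κ := by
    have ha : Measurable (actDiag h : (X × X) × (G ⧸ H) → _) :=
      measurable_actDiag.comp (measurable_prodMk_left (x := h))
    conv_rhs => rw [show κ = κ'.map Prod.fst from rfl, ← hκ' h]
    rw [Measure.map_map (measurable_const_vadd h) measurable_fst, Measure.map_map measurable_fst ha]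
    rfl
  have hform : ρ = (lam.prod κ).map (twistAt s (g : G ⧸ H)) := by
    rw [htw, ← hκκ']
    conv_lhs => rw [← Measure.map_id (μ := lam)]
    rw [Measure.map_prod_map _ _ measurable_id (by fun_prop), Measure.map_map ht (by fun_prop)]
    rfl
  -- Forgetting the constant difference loses nothing modulo null sets: `twistAt` is the inverse.
  let Ψ : Induced s X × Induced s X → Induced s (X × X) := fun p =>
    Induced.mk s (untwist s p).1 (untwist s p).2.1
  have hΨm : Measurable Ψ :=
    (show Measurable fun q : (G ⧸ H) × ((X × X) × (G ⧸ H)) => (q.1, q.2.1) by fun_prop).comp hu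
  have hΨ : ρ.map Ψ = Induced.measure s lam κ := by
    have h2 : (lam.prod κ').map (Prod.map id Prod.fst) = lam.prod κ := by
      rw [← Measure.map_prod_map _ _ measurable_id measurable_fst, Measure.map_id]
    rw [Induced.measure, ← h2, ← huntw, Measure.map_map (by fun_prop) hu]
    rfl
  have hΨeq (g : G) (p : Induced s X × Induced s X) : Ψ (g +ᵥ p) = g +ᵥ Ψ p := by
    change Induced.mk s (untwist s (g +ᵥ p)).1 (untwist s (g +ᵥ p)).2.1 = _
    rw [untwist_vadd]
    rfl
  refine ⟨κ, g, hκprob, ⟨?_, ?_, ?_⟩, hform, Ψ, ⟨hΨm, hΨ⟩,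
    ⟨twistAt s (g : G ⧸ H), ⟨measurable_twistAt s _, hform.symm⟩, ?_, ?_⟩, fun g =>
      Filter.Eventually.of_forall (hΨeq g)⟩
  · rw [← hfst]
    exact Measure.map_map measurable_fst measurable_fst
  · rw [← hsnd]
    exact Measure.map_map measurable_snd measurable_fst
  · have hvadd : VAddInvariantMeasure H (X × X) κ := ⟨fun h A hA => by
      conv_rhs => rw [← hκinv h]
      exact (Measure.map_apply (measurable_const_vadd h) hA).symm⟩
    refine ⟨fun {A} hA hAinv => ?_⟩
    have hA' : MeasurableSet (Prod.snd ⁻¹' A : Set ((G ⧸ H) × (X × X))) := measurable_snd hA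
    have hB : MeasurableSet (Ψ ⁻¹' (Prod.snd ⁻¹' A : Set ((G ⧸ H) × (X × X)))) := hΨm hA'
    have hΨq : Measure.QuasiMeasurePreserving Ψ ρ (lam.prod κ) :=
      MeasurePreserving.quasiMeasurePreserving ⟨hΨm, hΨ⟩
    -- On the fibre over `y`, the element `g` acts by the single element `h(g, y)` of `H`, so
    -- invariance of `A` modulo null sets suffices, one fibre at a time.
    have hprodinv (g : G) : ∀ᵐ q ∂(lam.prod κ),
        ((skewMap s (fun (h : H) (x : X × X) => h +ᵥ x) g q).2 ∈ A ↔ q.2 ∈ A) := by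
      have hsk : Measurable (Function.uncurry fun (h : H) (x : X × X) => h +ᵥ x) := by
        change Measurable fun p : H × (X × X) => (p.1 +ᵥ p.2.1, p.1 +ᵥ p.2.2)
        fun_prop
      have hmeas : MeasurableSet {q : (G ⧸ H) × (X × X) |
          (skewMap s (fun (h : H) (x : X × X) => h +ᵥ x) g q).2 ∈ A ↔ q.2 ∈ A} :=
        MeasurableSet.iff (measurable_snd.comp (measurable_skewMap_apply s hsk g) hA)
          (measurable_snd hA)
      rw [Measure.ae_prod_iff_ae_ae hmeas]
      refine Filter.Eventually.of_forall fun y => ?_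
      filter_upwards [hAinv (s.cocycle g y)] with x hx
      exact iff_of_eq hx
    have hconst := herg.aeconst_of_forall_preimage_vadd_ae_eq hB fun g => by
      filter_upwards [hΨq.ae (hprodinv g)] with p hp
      refine propext ?_
      change (Ψ (g +ᵥ p)).2 ∈ A ↔ (Ψ p).2 ∈ A
      rw [hΨeq]
      exact hp
    have hpush {C : Set (X × X)} (hC : MeasurableSet C) (h : ∀ᵐ p ∂ρ, (Ψ p).2 ∈ C) :
        ∀ᵐ x ∂κ, x ∈ C := by
      have h1 : ∀ᵐ q ∂(ρ.map Ψ), q.2 ∈ C :=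
        (ae_map_iff (p := fun q => q.2 ∈ C) hΨm.aemeasurable (measurable_snd hC)).2 h
      rw [hΨ] at h1
      exact (Measure.ae_ae_of_ae_prod h1).exists.choose_spec
    rw [Filter.eventuallyConst_set] at hconst ⊢
    exact hconst.imp (fun h => hpush hA h) (fun h => hpush hA.compl h)
  · filter_upwards [hg] with p hp
    have h1 : (untwist s p).2.2 = (g : G ⧸ H) := hp
    refine Eq.trans ?_ (twist_untwist s p)
    change twist s ((untwist s p).1, ((untwist s p).2.1, (g : G ⧸ H))) = _
    rw [← h1]
  · refine Filter.Eventually.of_forall fun q => ?_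
    change (((untwist s (twist s (q.1, (q.2, (g : G ⧸ H))))).1,
      (untwist s (twist s (q.1, (q.2, (g : G ⧸ H))))).2.1) : (G ⧸ H) × (X × X)) = q
    rw [untwist_twist]
    rfl

/-- A function whose graph carries `ρ` restricts to almost every fibre and gives one for `κ`;
conversely, one for `κ` is copied to all fibres, conjugated by the transport `h(s(y), c)`. -/
theorem isGraphOfIso_induced_iff [T2Space G] [MeasurableEq X] (s : BorelSection H)
    (lam : Measure (G ⧸ H)) [IsProbabilityMeasure lam] {μ : Measure X} [IsProbabilityMeasure μ]
    {ρ : Measure (Induced s X × Induced s X)} {κ : Measure (X × X)}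
    (hρ : IsErgodicSelfJoining G (Induced.measure s lam μ) ρ) (hκ : IsErgodicSelfJoining H μ κ)
    [IsProbabilityMeasure κ] (c : G ⧸ H) (hform : ρ = (lam.prod κ).map (twistAt s c)) :
    IsGraphOfIso G (Induced.measure s lam μ) ρ ↔ IsGraphOfIso H μ κ := by
  have := s.measurableAdd₂
  have := s.measurableNeg
  have := s.measurableEq
  have hs := s.measurable_toFun
  have := measurableConstVAdd_induced (X := X) s
  have : MeasurableConstVAdd G (Induced s X × Induced s X) := MeasurableConstVAdd.prod
  have : MeasurableConstVAdd H (X × X) := MeasurableConstVAdd.prod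
  have : MeasurableEq (Induced s X) := MeasurableEq.prod (α := G ⧸ H) (β := X)
  have herg := hρ.ergodic
  have hergκ := hκ.ergodic
  have hT := measurable_twistAt (X := X) (X' := X) s c
  have hk : Measurable fun y : G ⧸ H => s.cocycle (s y) c :=
    s.measurable_cocycle.comp (hs.prodMk measurable_const)
  rw [isGraphOfIso_iff hρ.map_fst hρ.map_snd fun g => MeasureTheory.map_vadd g ρ,
    isGraphOfIso_iff hκ.map_fst hκ.map_snd fun h => MeasureTheory.map_vadd h κ]
  have hpull {P : Induced s X × Induced s X → Prop} (h : ∀ᵐ p ∂ρ, P p) :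
      ∃ y, ∀ᵐ x ∂κ, P (twistAt s c (y, x)) := by
    rw [hform] at h
    exact (Measure.ae_ae_of_ae_prod (ae_of_ae_map hT.aemeasurable h)).exists
  have hpush {P : Induced s X × Induced s X → Prop} (hP : MeasurableSet {p | P p})
      (h : ∀ y, ∀ᵐ x ∂κ, P (twistAt s c (y, x))) : ∀ᵐ p ∂ρ, P p := by
    rw [hform, ae_map_iff hT.aemeasurable hP]
    exact (Measure.ae_prod_iff_ae_ae (p := fun q => P (twistAt s c q)) (hT hP)).2
      (Filter.Eventually.of_forall h)
  refine and_congr ⟨?_, ?_⟩ ⟨?_, ?_⟩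
  · rintro ⟨Q, hQ, hgQ⟩
    obtain ⟨y, hy⟩ := hpull hgQ
    refine ⟨fun x => -s.cocycle (s y) c +ᵥ (Q (Induced.mk s y x)).2, ?_, ?_⟩
    · exact (measurable_snd.comp (hQ.comp (measurable_prodMk_left (x := y)))).const_vadd _
    · filter_upwards [hy] with x hx
      refine (neg_vadd_vadd (s.cocycle (s y) c) x.2).symm.trans ?_
      exact congrArg (fun z => -s.cocycle (s y) c +ᵥ z) (congrArg Prod.snd hx)
  · rintro ⟨R, hR, hgR⟩
    have hQ : Measurable fun z : Induced s X =>
        Induced.mk s (c + z.1) (s.cocycle (s z.1) c +ᵥ R z.2) := by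
      change Measurable fun z : (G ⧸ H) × X => (c + z.1, s.cocycle (s z.1) c +ᵥ R z.2)
      have hk' : Measurable fun z : (G ⧸ H) × X => s.cocycle (s z.1) c := hk.comp measurable_fst
      fun_prop
    refine ⟨_, hQ, hpush (measurableSet_eq_fun measurable_snd (hQ.comp measurable_fst))
      fun y => ?_⟩
    filter_upwards [hgR] with x hx
    change (c + y, s.cocycle (s y) c +ᵥ x.2) = (c + y, s.cocycle (s y) c +ᵥ R x.1)
    rw [hx]
  · rintro ⟨Q, hQ, hgQ⟩
    obtain ⟨y, hy⟩ := hpull hgQ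
    refine ⟨fun x => (Q (Induced.mk s (c + y) (s.cocycle (s y) c +ᵥ x))).2, ?_, ?_⟩
    · exact measurable_snd.comp (hQ.comp ((measurable_prodMk_left (x := c + y)).comp
        (measurable_const_vadd _)))
    · filter_upwards [hy] with x hx
      exact congrArg Prod.snd hx
  · rintro ⟨R, hR, hgR⟩
    have hQ : Measurable fun z : Induced s X =>
        Induced.mk s (-c + z.1) (R (-s.cocycle (s (-c + z.1)) c +ᵥ z.2)) := by
      change Measurable fun z : (G ⧸ H) × X =>
        (-c + z.1, R (-s.cocycle (s (-c + z.1)) c +ᵥ z.2))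
      have hk' : Measurable fun z : (G ⧸ H) × X => s.cocycle (s (-c + z.1)) c :=
        hk.comp (by fun_prop)
      fun_prop
    refine ⟨_, hQ, hpush (measurableSet_eq_fun measurable_fst (hQ.comp measurable_snd))
      fun y => ?_⟩
    filter_upwards [hgR] with x hx
    change (y, x.1) = (-c + (c + y), R (-s.cocycle (s (-c + (c + y))) c +ᵥ
      (s.cocycle (s y) c +ᵥ x.2)))
    rw [neg_add_cancel_left, neg_vadd_vadd, hx]


/-! ### Isomorphism of induced actions -/

theorem ActionIsomorphic.induced [MeasurableEq X'] (s : BorelSection H)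
    (lam : Measure (G ⧸ H)) [IsProbabilityMeasure lam] {μ : Measure X} [IsProbabilityMeasure μ]
    {μ' : Measure X'} [IsProbabilityMeasure μ'] (h : ActionIsomorphic H μ μ') :
    ActionIsomorphic G (Induced.measure s lam μ) (Induced.measure s lam μ') := by
  obtain ⟨φ, hφ, ⟨ψ, hψ, h1, h2⟩, h3⟩ := h
  have hs := s.measurable_toFun
  have hφm := hφ.measurable
  have hψm := hψ.measurable
  refine ⟨fun z => Induced.mk s z.1 (φ z.2), (MeasurePreserving.id lam).prod hφ,
    ⟨fun z => Induced.mk s z.1 (ψ z.2), (MeasurePreserving.id lam).prod hψ, ?_, ?_⟩, fun g => ?_⟩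
  · refine (Measure.quasiMeasurePreserving_snd (μ := lam) (ν := μ)).ae h1 |>.mono fun z hz => ?_
    exact Prod.ext rfl hz
  · refine (Measure.quasiMeasurePreserving_snd (μ := lam) (ν := μ')).ae h2 |>.mono fun z hz => ?_
    exact Prod.ext rfl hz
  · have hk : Measurable fun z : (G ⧸ H) × X => s.cocycle g z.1 :=
      s.measurable_cocycle.comp (measurable_const.prodMk measurable_fst)
    have key : ∀ᵐ z ∂lam.prod μ, φ (s.cocycle g z.1 +ᵥ z.2) = s.cocycle g z.1 +ᵥ φ z.2 := by
      rw [Measure.ae_prod_iff_ae_ae (measurableSet_eq_fun (by fun_prop) (by fun_prop))]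
      exact Filter.Eventually.of_forall fun y => h3 (s.cocycle g y)
    filter_upwards [key] with z hz
    exact Prod.ext rfl hz

/-- No ergodicity is available, so the base difference `c` need not be constant on the graph of `Q`.
The forward map reads `c` from `Q` on a fixed fibre; the inverse needs `c` as a function of the
transported second coordinate. -/
theorem ActionIsomorphic.of_induced [LocallyCompactSpace G] [T2Space G]
    (hH : IsClosed (H : Set G)) [MeasurableEq X] [MeasurableEq X'] (s : BorelSection H)
    (lam : Measure (G ⧸ H)) [lam.IsAddLeftInvariant] [IsProbabilityMeasure lam]
    {μ : Measure X} [IsProbabilityMeasure μ] [VAddInvariantMeasure H X μ]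
    {μ' : Measure X'} [IsProbabilityMeasure μ']
    (h : ActionIsomorphic G (Induced.measure s lam μ) (Induced.measure s lam μ')) :
    ActionIsomorphic H μ μ' := by
  obtain ⟨Q, hQ⟩ := h
  have := s.measurableAdd₂
  have := s.measurableNeg
  have := s.measurableEq
  have hs := s.measurable_toFun
  have := measurableConstVAdd_induced (X := X) s
  have := measurableConstVAdd_induced (X := X') s
  have : MeasurableConstVAdd H (X × X') := MeasurableConstVAdd.prod
  have : MeasurableEq (Induced s X) := MeasurableEq.prod (α := G ⧸ H) (β := X)
  have : MeasurableEq (Induced s X') := MeasurableEq.prod (α := G ⧸ H) (β := X')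
  have := vaddInvariantMeasure_induced s lam μ
  have hu := measurable_untwist (X := X) (X' := X') s
  have ht := measurable_twist (X := X) (X' := X') s
  have hQm : Measurable Q := hQ.1.measurable
  obtain ⟨hfst, hsnd, hgQ, Q', hQ'm, hgQ'⟩ := hQ.ae_eq_graph
  have hinv := hQ.map_vadd_graph
  set ρ := (Induced.measure s lam μ).map (fun z => (z, Q z))
  obtain ⟨κ', hprob, hκ', hκfst, huntw, htw⟩ := exists_map_untwist_eq_prod s lam μ hfst hinv
  obtain ⟨hlaw, hprod⟩ := map_untwist_snd hH s lam (μ' := μ') hsnd hinv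
  have hd : Measurable fun p : Induced s X × Induced s X' => (p.2.2, -p.1.1 + p.2.1) := by
    change Measurable fun p : ((G ⧸ H) × X) × ((G ⧸ H) × X') => (p.2.2, -p.1.1 + p.2.1)
    fun_prop
  have hf : Measurable fun p : Induced s X × Induced s X' =>
      (p.2.1, (p.2.2, -p.1.1 + p.2.1)) := by
    change Measurable fun p : ((G ⧸ H) × X) × ((G ⧸ H) × X') => (p.2.1, (p.2.2, -p.1.1 + p.2.1))
    fun_prop
  have hu' : Measurable fun p : Induced s X × Induced s X' =>
      ((untwist s p).2.1.2, (untwist s p).2.2) :=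
    (show Measurable fun q : (G ⧸ H) × ((X × X') × (G ⧸ H)) => (q.2.1.2, q.2.2) by
      fun_prop).comp hu
  have hρprob : IsProbabilityMeasure ρ := by
    have : IsProbabilityMeasure (lam.prod κ') := inferInstance
    rw [htw]
    exact Measure.isProbabilityMeasure_map ht.aemeasurable
  have hdprob : IsProbabilityMeasure (ρ.map fun p => (p.2.2, -p.1.1 + p.2.1)) :=
    Measure.isProbabilityMeasure_map hd.aemeasurable
  -- Seen from the second base point, `Q'` determines `c`. The law there is a product, so `y₂` can
  -- be frozen, making `c` a function of `x₂`; `hlaw` transfers this to the transported coordinate.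
  obtain ⟨c', hc'm, hc'⟩ : ∃ c' : X' → G ⧸ H, Measurable c' ∧
      ∀ᵐ p ∂ρ, (untwist s p).2.2 = c' (untwist s p).2.1.2 := by
    have hQ1 : Measurable fun q : (G ⧸ H) × X' => (Q' (Induced.mk s q.1 q.2)).1 :=
      measurable_fst.comp hQ'm
    have h1 : ∀ᵐ q ∂(ρ.map fun p => (p.2.1, (p.2.2, -p.1.1 + p.2.1))),
        q.2.2 = -(Q' (Induced.mk s q.1 q.2.1)).1 + q.1 := by
      have hQ2 : Measurable fun q : (G ⧸ H) × (X' × (G ⧸ H)) =>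
          -(Q' (Induced.mk s q.1 q.2.1)).1 + q.1 :=
        (hQ1.comp (measurable_fst.prodMk measurable_snd.fst)).neg.add measurable_fst
      refine (ae_map_iff (p := fun q : (G ⧸ H) × (X' × (G ⧸ H)) =>
        q.2.2 = -(Q' (Induced.mk s q.1 q.2.1)).1 + q.1) hf.aemeasurable
        (measurableSet_eq_fun measurable_snd.snd hQ2)).2 ?_
      filter_upwards [hgQ'] with p hp
      exact congrArg (fun z : Induced s X => -z.1 + p.2.1) hp
    rw [hprod] at h1
    obtain ⟨y, hy⟩ := (Measure.ae_ae_of_ae_prod h1).exists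
    rw [← hlaw] at hy
    exact ⟨fun x => -(Q' (Induced.mk s y x)).1 + y,
      (hQ1.comp measurable_prodMk_left).neg.add_const _, ae_of_ae_map hu'.aemeasurable hy⟩
  have hall : ∀ᵐ p ∂ρ, p.2 = Q p.1 ∧ p.1 = Q' p.2 ∧
      (untwist s p).2.2 = c' (untwist s p).2.1.2 := by
    filter_upwards [hgQ, hgQ', hc'] with p h1 h2 h3 using ⟨h1, h2, h3⟩
  rw [htw] at hall
  -- One base point `y` over which all three relations hold for `κ'`-almost every point.
  obtain ⟨y, hy⟩ := (Measure.ae_ae_of_ae_prod (ae_of_ae_map ht.aemeasurable hall)).exists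
  simp only [untwist_twist] at hy
  have hk : Measurable fun c : G ⧸ H => s.cocycle (s y) c :=
    s.measurable_cocycle.comp measurable_prodMk_left
  let κ := κ'.map Prod.fst
  have hκ1 : κ.map Prod.fst = μ := by
    rw [← hκfst]
    exact Measure.map_map measurable_fst measurable_fst
  have hκ2 : κ.map Prod.snd = μ' := by
    have h1 : (lam.prod κ').map Prod.snd = κ' := by rw [Measure.map_snd_prod]; simp
    rw [Measure.map_map measurable_snd measurable_fst]
    conv_lhs => rw [← h1, ← huntw, Measure.map_map measurable_snd hu,
      Measure.map_map (by fun_prop) (measurable_snd.comp hu)]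
    exact map_untwist_snd_fst hH s lam hsnd hinv
  have hκinv (h : H) : κ.map (fun p => h +ᵥ p) = κ := by
    have ha : Measurable (actDiag h : (X × X') × (G ⧸ H) → _) :=
      measurable_actDiag.comp (measurable_prodMk_left (x := h))
    conv_rhs => rw [show κ = κ'.map Prod.fst from rfl, ← hκ' h]
    rw [Measure.map_map (measurable_const_vadd h) measurable_fst, Measure.map_map measurable_fst ha]
    rfl
  have hQ1 : Measurable fun x : X => (Q (Induced.mk s y x)).1 :=
    measurable_fst.comp (hQm.comp (measurable_prodMk_left (x := y)))
  have hQ2 : Measurable fun x : X => (Q (Induced.mk s y x)).2 :=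
    measurable_snd.comp (hQm.comp (measurable_prodMk_left (x := y)))
  -- On the fibre over `y`, apply `Q`, read off `c` as the displacement of the base point, and
  -- transport back.
  have hR : Measurable fun x : X =>
      -s.cocycle (s y) ((Q (Induced.mk s y x)).1 + -y) +ᵥ (Q (Induced.mk s y x)).2 :=
    ((hk.comp (hQ1.add_const _)).neg).vadd hQ2
  have hR' : Measurable fun x : X' =>
      (Q' (Induced.mk s (c' x + y) (s.cocycle (s y) (c' x) +ᵥ x))).2 :=
    measurable_snd.comp (hQ'm.comp
      ((hc'm.add_const _).prodMk ((hk.comp hc'm).vadd measurable_id)))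
  refine ⟨_, (isActionIso_of_ae_eq hκ1 hκ2 hκinv hR hR' ?_ ?_).1⟩
  · refine (ae_map_iff measurable_fst.aemeasurable
      (measurableSet_eq_fun measurable_snd (hR.comp measurable_fst))).2 ?_
    filter_upwards [hy] with q hq
    have h1 : (q.2 + y, s.cocycle (s y) q.2 +ᵥ q.1.2) = Q (Induced.mk s y q.1.1) := hq.1
    change q.1.2 = -s.cocycle (s y) ((Q (Induced.mk s y q.1.1)).1 + -y) +ᵥ
      (Q (Induced.mk s y q.1.1)).2
    rw [← h1]
    change q.1.2 = -s.cocycle (s y) (q.2 + y + -y) +ᵥ (s.cocycle (s y) q.2 +ᵥ q.1.2)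
    rw [add_neg_cancel_right, neg_vadd_vadd]
  · refine (ae_map_iff measurable_fst.aemeasurable
      (measurableSet_eq_fun measurable_fst (hR'.comp measurable_snd))).2 ?_
    filter_upwards [hy] with q hq
    change q.1.1 = (Q' (Induced.mk s (c' q.1.2 + y) (s.cocycle (s y) (c' q.1.2) +ᵥ q.1.2))).2
    rw [← hq.2.2]
    exact congrArg Prod.snd hq.2.1

end

theorem proposition1p3 {G : Type*} [AddCommGroup G] [TopologicalSpace G] [IsTopologicalAddGroup G]
    [LocallyCompactSpace G] [SecondCountableTopology G] [T2Space G]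
    [MeasurableSpace G] [BorelSpace G]
    (H : AddSubgroup G) (hH : IsClosed (H : Set G)) [CompactSpace (G ⧸ H)]
    (lam : Measure (G ⧸ H)) [lam.IsAddHaarMeasure] [IsProbabilityMeasure lam]
    (s : BorelSection H)
    {X : Type*} [MeasurableSpace X] [StandardBorelSpace X]
    (μ : Measure X) [IsProbabilityMeasure μ]
    [AddAction H X] [MeasurableVAdd₂ H X] [VAddInvariantMeasure H X μ]
    {X' : Type*} [MeasurableSpace X'] [StandardBorelSpace X']
    (μ' : Measure X') [IsProbabilityMeasure μ']
    [AddAction H X'] [MeasurableVAdd₂ H X'] [VAddInvariantMeasure H X' μ'] :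
    (ErgodicVAdd H X μ →
      ∀ ρ : Measure (Induced s X × Induced s X),
        IsErgodicSelfJoining G (Induced.measure s lam μ) ρ →
        (∃ (κ : Measure (X × X)) (g : G),
          IsErgodicSelfJoining H μ κ ∧
          IsIntegralOfFibres s lam κ g ρ ∧
          ActionIsomorphic G ρ (Induced.measure s lam κ)) ∧
        (∀ (κ : Measure (X × X)) (g : G),
          IsErgodicSelfJoining H μ κ → IsIntegralOfFibres s lam κ g ρ →
          (IsGraphOfIso G (Induced.measure s lam μ) ρ ↔ IsGraphOfIso H μ κ))) ∧
    (ActionIsomorphic G (Induced.measure s lam μ) (Induced.measure s lam μ') ↔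
      ActionIsomorphic H μ μ') := by
  have hX : MeasurableEq X := inferInstance
  refine ⟨fun _ ρ hρ => ⟨?_, fun κ g hκ hform => ?_⟩,
    fun h => h.of_induced hH s lam, fun h => h.induced s lam⟩
  · obtain ⟨κ, g, _, hκ, hform, hiso⟩ := exists_ergodic_fibre_joining hH s lam μ hρ
    exact ⟨κ, g, hκ, (isIntegralOfFibres_iff s lam κ g ρ).2 hform, hiso⟩
  -- Finiteness of `κ` is not part of being a self-joining; it comes from its marginal `μ`.
  · have : IsProbabilityMeasure κ := by
      have : IsProbabilityMeasure (κ.map Prod.fst) := by rw [hκ.map_fst]; infer_instance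
      exact Measure.isProbabilityMeasure_of_map Prod.fst
    exact isGraphOfIso_induced_iff s lam hρ hκ _ ((isIntegralOfFibres_iff s lam κ g ρ).1 hform)
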